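/- For a finite word $w$ over an alphabet $A$ let $|w|$ be its length and let $|w|_{\mathrm{pal}}$ be its palindromic length, that is, the least number of palindromes whose concatenation is $w$ (so the empty word has palindromic length $0$). The word $w$ is called rich if it has exactly $|w|+1$ distinct palindromic factors, the empty word included. There is a constant $c>0$, and for every $q$ there is a constant $d>1$ depending only on $q$, such that for every finite alphabet $A$ with exactly $q$ letters: (i) if $q\ge 2$, then $|w|_{\mathrm{pal}}\ge c\sqrt{|w|}$ for infinitely many finite rich words $w$ over $A$; (ii) $|w|_{\mathrm{pal}}\le d\,\dfrac{|w|}{\ln|w|}$ for every rich word $w$ over $A$ with $|w|\ge 2$. -/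

import Mathlib

universe u

/-- The set of palindromic factors of a finite word `w`, the empty word included
(`p <:+: w` says that `w = x ++ p ++ y` for some words `x`, `y`). -/
def palindromicFactors {A : Type u} (w : List A) : Set (List A) :=
  {p | p <:+: w ∧ p.Palindrome}

/-- A finite word `w` is rich if it has exactly `|w| + 1` distinct palindromic factors,
the largest possible number. -/
def IsRich {A : Type u} (w : List A) : Prop :=
  (palindromicFactors w).ncard = w.length + 1

/-- The palindromic length of a finite word `w`: the least number of palindromes whose
concatenation is `w`. It is `0` for the empty word, the concatenation of the empty list. -/
noncomputable def palLength {A : Type u} (w : List A) : ℕ :=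
  sInf {k : ℕ | ∃ ps : List (List A), ps.length = k ∧ (∀ p ∈ ps, p.Palindrome) ∧ ps.flatten = w}

/-- The minimum in the definition of `palLength` is attained. -/
theorem palLength_spec {A : Type u} (w : List A) :
    ∃ ps : List (List A), ps.length = palLength w ∧ (∀ p ∈ ps, p.Palindrome) ∧ ps.flatten = w := by
  refine Nat.sInf_mem
    (s := {k : ℕ | ∃ ps : List (List A),
      ps.length = k ∧ (∀ p ∈ ps, p.Palindrome) ∧ ps.flatten = w}) ?_
  refine ⟨w.length, w.map (fun a => [a]), by simp, ?_, ?_⟩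
  · intro p hp
    obtain ⟨a, -, rfl⟩ := List.mem_map.1 hp
    exact List.Palindrome.singleton a
  · induction w with
    | nil => rfl
    | cons a w ih => simpa using ih

/-!
Both parts rest on one fact: a palindromic prefix of `x :: w` that is shorter than another
palindromic prefix `p` is also a suffix of `p`, hence a factor of `w`. So prepending a letter creates
at most one new palindromic factor (`palindromicFactors_cons_subset`), and a word `w` has at most
`|w| + 1` of them (`ncard_palindromicFactors_le`).

Upper bound. It follows that suffixes of rich words are rich, and that a nonempty rich word `x :: w`
begins with a palindrome which is not a factor of `w` (`IsRich.of_cons`). Splitting off such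
palindromes from the left factors a rich word into *distinct* nonempty palindromes
(`IsRich.exists_nodup_palindromes`). Among distinct words of total length `n` over `q` letters, at
most `n / L` have length at least `L` and at most `(q + 1) ^ L` are shorter; taking `L` of the order
of `log n` gives `O(n / log n)`.

Lower bound. The word `b a b a² b a³ ⋯ b aᵏ` has length `k (k + 3) / 2`, and listing the palindromes
`aⁱ`, `aⁱ b aⁱ` and `aⁱ b aᵐ b aⁱ` inside it shows that it is rich (`isRich_staircase`). Its runs of
`a` between consecutive letters `b` have distinct lengths, so no palindromic factor contains more than
two letters `b` (`count_le_two_of_palindrome`): in a palindrome the first inner run would recur as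
the last. Hence its palindromic length is at least `k / 2`.
-/

/-! ### Palindromic factors and prepending a letter -/

theorem palindromicFactors_finite {A : Type u} (w : List A) : (palindromicFactors w).Finite := by
  refine (List.finite_toSet w.sublists).subset ?_
  rintro p ⟨hp, -⟩
  exact List.mem_sublists.2 hp.sublist

/-- A palindromic prefix of `x :: w` that is shorter than another one is a factor of `w`. -/
theorem infix_of_palindromic_prefix {A : Type u} {x : A} {w p r : List A}
    (hp : p.Palindrome) (hr : r.Palindrome) (hpw : p <+: x :: w) (hrw : r <+: x :: w)
    (hlt : p.length < r.length) : p <:+: w := by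
  have h1 : p <+: r := List.prefix_of_prefix_length_le hpw hrw hlt.le
  have h2 : p <:+ r := by
    have := List.reverse_suffix.2 h1
    rwa [hp.reverse_eq, hr.reverse_eq] at this
  rcases r with _ | ⟨y, r⟩
  · simp at hlt
  · rcases List.suffix_cons_iff.1 h2 with h | h
    · rw [h] at hlt
      exact absurd hlt (lt_irrefl _)
    · exact h.isInfix.trans (List.cons_prefix_cons.1 hrw).2.isInfix

/-- Prepending a letter creates at most one new palindromic factor: the longest palindromic prefix. -/
theorem palindromicFactors_cons_subset {A : Type u} (x : A) (w : List A) :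
    ∃ p, palindromicFactors (x :: w) ⊆ insert p (palindromicFactors w) := by
  by_cases h : ∃ p, p ∈ palindromicFactors (x :: w) ∧ p ∉ palindromicFactors w
  · obtain ⟨p, hp, hpw⟩ := h
    have key : ∀ r, r ∈ palindromicFactors (x :: w) → r ∉ palindromicFactors w → r <+: x :: w :=
      fun r hr hrw => (List.infix_cons_iff.1 hr.1).resolve_right fun h => hrw ⟨h, hr.2⟩
    refine ⟨p, fun r hr => ?_⟩
    by_cases hrw : r ∈ palindromicFactors w
    · exact Or.inr hrw
    left
    have h1 := key p hp hpw
    have h2 := key r hr hrw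
    rcases lt_trichotomy p.length r.length with h | h | h
    · exact absurd ⟨infix_of_palindromic_prefix hp.2 hr.2 h1 h2 h, hp.2⟩ hpw
    · exact (List.prefix_of_prefix_length_le h2 h1 h.ge).eq_of_length h.symm
    · exact absurd ⟨infix_of_palindromic_prefix hr.2 hp.2 h2 h1 h, hr.2⟩ hrw
  · push Not at h
    exact ⟨[], fun r hr => Or.inr (h r hr)⟩

theorem ncard_palindromicFactors_cons_le {A : Type u} (x : A) (w : List A) :
    (palindromicFactors (x :: w)).ncard ≤ (palindromicFactors w).ncard + 1 := by
  obtain ⟨p, hp⟩ := palindromicFactors_cons_subset x w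
  exact (Set.ncard_le_ncard hp ((palindromicFactors_finite w).insert p)).trans
    (Set.ncard_insert_le _ _)

theorem ncard_palindromicFactors_le {A : Type u} (w : List A) :
    (palindromicFactors w).ncard ≤ w.length + 1 := by
  induction w with
  | nil =>
    have : palindromicFactors ([] : List A) ⊆ {[]} := fun p hp => by
      simpa using hp.1
    simpa using Set.ncard_le_ncard this
  | cons x w ih =>
    have := ncard_palindromicFactors_cons_le x w
    simp only [List.length_cons]
    omega

/-! ### Rich words as products of distinct palindromes -/

/-- The tail of a rich word is rich, and the palindromic factor lost with the first letter is a
prefix. -/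
theorem IsRich.of_cons {A : Type u} {x : A} {w : List A} (h : IsRich (x :: w)) :
    IsRich w ∧ ∃ p : List A, p.Palindrome ∧ p <+: x :: w ∧ ¬ p <:+: w := by
  have h1 := ncard_palindromicFactors_cons_le x w
  have h2 := ncard_palindromicFactors_le w
  unfold IsRich at h ⊢
  rw [List.length_cons] at h
  refine ⟨by omega, ?_⟩
  obtain ⟨p, hp, hpw⟩ := Set.exists_mem_notMem_of_ncard_lt_ncard
    (s := palindromicFactors w) (t := palindromicFactors (x :: w)) (by omega)
    (palindromicFactors_finite w)
  have hnot : ¬ p <:+: w := fun h => hpw ⟨h, hp.2⟩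
  exact ⟨p, hp.2, (List.infix_cons_iff.1 hp.1).resolve_right hnot, hnot⟩

theorem IsRich.of_suffix {A : Type u} {t w : List A} (hw : IsRich w) (h : t <:+ w) : IsRich t := by
  induction w with
  | nil => rwa [List.suffix_nil.1 h]
  | cons x w ih =>
    rcases List.suffix_cons_iff.1 h with rfl | h
    · exact hw
    · exact ih hw.of_cons.1 h

theorem IsRich.exists_nodup_palindromes {A : Type u} {w : List A} (hw : IsRich w) :
    ∃ ps : List (List A), ps.Nodup ∧ (∀ p ∈ ps, p.Palindrome) ∧ ps.flatten = w := by
  induction hn : w.length using Nat.strong_induction_on generalizing w with | _ n ih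
  subst hn
  rcases w with _ | ⟨x, w⟩
  · exact ⟨[], by simp, by simp, by simp⟩
  obtain ⟨-, p, hp, ⟨t, ht⟩, hpw⟩ := hw.of_cons
  rcases p with _ | ⟨y, p⟩
  · exact absurd (List.nil_infix) hpw
  have hwt : p ++ t = w := (List.cons.inj ht).2
  have hlen := congrArg List.length hwt
  simp only [List.length_append] at hlen
  obtain ⟨ps, hnd, hpal, hfl⟩ :=
    ih t.length (by simp only [List.length_cons]; omega) (hw.of_suffix ⟨_, ht⟩) rfl
  refine ⟨(y :: p) :: ps, List.nodup_cons.2 ⟨fun hmem => hpw ?_, hnd⟩, ?_, ?_⟩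
  · -- a later factor is a factor of `t`, hence of `w`
    have h1 : (y :: p) <:+: ps.flatten := List.infix_of_mem_flatten hmem
    rw [hfl] at h1
    exact h1.trans (List.IsSuffix.isInfix ⟨p, hwt⟩)
  · intro r hr
    rcases List.mem_cons.1 hr with rfl | hr
    · exact hp
    · exact hpal r hr
  · rw [List.flatten_cons, hfl, ht]

theorem palLength_le_of_flatten {A : Type u} {w : List A} {ps : List (List A)}
    (hpal : ∀ p ∈ ps, p.Palindrome) (hfl : ps.flatten = w) : palLength w ≤ ps.length :=
  Nat.sInf_le ⟨ps, rfl, hpal, hfl⟩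

/-! ### Counting distinct words of bounded total length -/

theorem length_le_of_nodup_of_length_lt {A : Type u} [Fintype A] (L : ℕ) {ps : List (List A)}
    (hnd : ps.Nodup) (hlt : ∀ p ∈ ps, p.length < L) :
    ps.length ≤ (Fintype.card A + 1) ^ L := by
  classical
  have hinj : Set.InjOn (fun (p : List A) (i : Fin L) => p[(i : ℕ)]?)
      (ps.toFinset : Set (List A)) := by
    intro p hp r hr h
    have hp := hlt p (by simpa using hp)
    have hr := hlt r (by simpa using hr)
    refine List.ext_getElem? fun i => ?_
    by_cases hi : i < L
    · exact congrFun h ⟨i, hi⟩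
    · rw [List.getElem?_eq_none (by omega), List.getElem?_eq_none (by omega)]
  have h := Finset.card_le_card_of_injOn (t := Finset.univ) _
    (fun _ _ => Finset.mem_coe.2 (Finset.mem_univ _)) hinj
  rw [List.toFinset_card_of_nodup hnd] at h
  simpa using h

theorem length_mul_le_length_flatten {A : Type u} (L : ℕ) {ps : List (List A)}
    (hle : ∀ p ∈ ps, L ≤ p.length) : ps.length * L ≤ ps.flatten.length := by
  induction ps with
  | nil => simp
  | cons p ps ih =>
    have h1 := ih fun r hr => hle r (List.mem_cons_of_mem _ hr)
    have h2 := hle p List.mem_cons_self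
    simp only [List.length_cons, List.flatten_cons, List.length_append]
    linarith

theorem mul_length_le_of_nodup {A : Type u} [Fintype A] (L : ℕ) {ps : List (List A)}
    (hnd : ps.Nodup) :
    ps.length * L ≤ ps.flatten.length + (Fintype.card A + 1) ^ L * L := by
  classical
  have h1 := length_le_of_nodup_of_length_lt L (hnd.filter (fun p => decide (p.length < L)))
    (by intro p hp; simpa using (List.mem_filter.1 hp).2)
  have h2 := length_mul_le_length_flatten L (ps := ps.filter (fun p => ! decide (p.length < L)))
    (by intro p hp; simpa using (List.mem_filter.1 hp).2)
  have h3 := List.length_eq_length_filter_add (l := ps) (fun p => decide (p.length < L))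
  have h4 : (ps.filter (fun p => ! decide (p.length < L))).flatten.length ≤ ps.flatten.length :=
    (List.Sublist.flatten List.filter_sublist).length_le
  have h5 := Nat.mul_le_mul_right L h1
  rw [h3, add_mul]
  omega

/-- Optimizing `P ≤ n / L + Q ^ L` over `L`. -/
theorem le_div_log_of_forall_mul_le {n P Q : ℕ} (hn : 2 ≤ n) (hQ : 2 ≤ Q)
    (h : ∀ L : ℕ, P * L ≤ n + Q ^ L * L) :
    (P : ℝ) ≤ (2 * Real.log Q + 2 * Q) * ((n : ℝ) / Real.log n) := by
  have hn' : (2 : ℝ) ≤ n := by exact_mod_cast hn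
  have hQ' : (2 : ℝ) ≤ Q := by exact_mod_cast hQ
  have hlogn : 0 < Real.log n := Real.log_pos (by linarith)
  have hlogQ : 0 < Real.log Q := Real.log_pos (by linarith)
  -- the choice `Q ^ L ≈ √n` makes the second term negligible
  set y : ℝ := Real.log n / (2 * Real.log Q) with hy
  have hy0 : 0 < y := by positivity
  set L : ℕ := ⌈y⌉₊ with hL
  have hyL : y ≤ L := Nat.le_ceil y
  have hLy : (L : ℝ) < y + 1 := Nat.ceil_lt_add_one hy0.le
  have hL0 : (0 : ℝ) < L := hy0.trans_le hyL
  have h1 : (P : ℝ) * L ≤ n + (Q : ℝ) ^ L * L := by exact_mod_cast h L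
  have h2 : (P : ℝ) ≤ n / L + (Q : ℝ) ^ L := by
    rw [← mul_le_mul_iff_left₀ hL0, add_mul, div_mul_cancel₀ _ hL0.ne']
    exact h1
  have h3 : (n : ℝ) / L ≤ 2 * Real.log Q * (n / Real.log n) := by
    calc (n : ℝ) / L ≤ n / y := by gcongr
      _ = 2 * Real.log Q * (n / Real.log n) := by rw [hy]; field_simp
  have hsq : Real.sqrt n * Real.sqrt n = n := Real.mul_self_sqrt (by linarith)
  have hs0 : 0 < Real.sqrt n := Real.sqrt_pos.2 (by linarith)
  have h4 : (Q : ℝ) ^ L ≤ Q * Real.sqrt n := by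
    have hQ0 : (0 : ℝ) < Q := by linarith
    calc (Q : ℝ) ^ L = (Q : ℝ) ^ (L : ℝ) := (Real.rpow_natCast _ _).symm
      _ ≤ (Q : ℝ) ^ (y + 1) := Real.rpow_le_rpow_of_exponent_le (by linarith) hLy.le
      _ = Q * (Q : ℝ) ^ y := by rw [Real.rpow_add hQ0, Real.rpow_one, mul_comm]
      _ = Q * Real.sqrt n := by
        congr 1
        rw [Real.rpow_def_of_pos hQ0, Real.sqrt_eq_rpow, Real.rpow_def_of_pos (by linarith)]
        congr 1
        rw [hy]
        field_simp
  have h5 : Real.sqrt n ≤ 2 * (n / Real.log n) := by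
    have hlog : Real.log n ≤ 2 * Real.sqrt n := by
      have := Real.log_le_sub_one_of_pos hs0
      rw [Real.log_sqrt (by linarith)] at this
      linarith
    rw [← mul_div_assoc, le_div_iff₀ hlogn]
    nlinarith
  have h6 : (Q : ℝ) * Real.sqrt n ≤ Q * (2 * (n / Real.log n)) := by gcongr
  linarith

theorem IsRich.palLength_le {A : Type u} [Fintype A] {w : List A} (hw : IsRich w)
    (hlen : 2 ≤ w.length) :
    (palLength w : ℝ) ≤
      (2 * Real.log ((Fintype.card A + 2 : ℕ) : ℝ) + 2 * ((Fintype.card A + 2 : ℕ) : ℝ)) *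
        ((w.length : ℝ) / Real.log (w.length : ℝ)) := by
  obtain ⟨ps, hnd, hpal, hfl⟩ := hw.exists_nodup_palindromes
  have h1 : (palLength w : ℝ) ≤ ps.length := by exact_mod_cast palLength_le_of_flatten hpal hfl
  refine h1.trans (le_div_log_of_forall_mul_le hlen (by omega) fun L => ?_)
  have h2 := mul_length_le_of_nodup L hnd
  rw [hfl] at h2
  refine h2.trans ?_
  gcongr
  omega

/-! ### A family of rich words with long palindromic length -/

/-- The word `b aʲ b aʲ⁺¹ ⋯ b aʲ⁺ᵏ⁻¹` with `k` letters `b`. -/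
def staircase {A : Type u} (a b : A) : ℕ → ℕ → List A
  | _, 0 => []
  | j, k + 1 => b :: (List.replicate j a ++ staircase a b (j + 1) k)

theorem staircase_succ {A : Type u} (a b : A) (j k : ℕ) :
    staircase a b j (k + 1) = staircase a b j k ++ b :: List.replicate (j + k) a := by
  induction k generalizing j with
  | zero => simp [staircase]
  | succ k ih =>
    rw [staircase, ih (j + 1), staircase]
    simp [Nat.add_assoc, Nat.add_comm 1 k]

theorem count_staircase {A : Type u} [DecidableEq A] {a b : A} (hab : a ≠ b) (j k : ℕ) :
    (staircase a b j k).count b = k := by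
  induction k with
  | zero => simp [staircase]
  | succ k ih => simp [staircase_succ, ih, List.count_replicate, hab]

theorem length_staircase {A : Type u} (a b : A) (k : ℕ) :
    (staircase a b 1 k).length = ∑ m ∈ Finset.range k, m + 2 * k := by
  induction k with
  | zero => simp [staircase]
  | succ k ih =>
    rw [staircase_succ, Finset.sum_range_succ]
    simp only [List.length_append, List.length_cons, List.length_replicate, ih]
    ring

theorem staircase_eq_nil_or_cons {A : Type u} (a b : A) (j k : ℕ) :
    staircase a b j k = [] ∨ ∃ t, staircase a b j k = b :: t := by
  cases k with
  | zero => exact Or.inl rfl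
  | succ k => exact Or.inr ⟨_, rfl⟩

/-- In a staircase word the length of a run between consecutive letters `b` determines the position
of that run. -/
theorem length_run_staircase {A : Type u} [DecidableEq A] {a b : A} (hab : a ≠ b) {y Y : List A}
    (hy : b ∉ y) (k : ℕ) : ∀ (j : ℕ) (X : List A),
      staircase a b j k = X ++ b :: (y ++ b :: Y) → y.length = j + X.count b := by
  have hrep : ∀ {j : ℕ} {s t : List A}, List.replicate j a ≠ s ++ b :: t := by
    intro j s t h
    have hb : b ∈ List.replicate j a := by rw [h]; simp
    exact hab (List.eq_of_mem_replicate hb).symm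
  induction k with
  | zero => intro j X h; simp [staircase] at h
  | succ k ih =>
    intro j X h
    rw [staircase] at h
    rcases X with _ | ⟨x, X⟩
    · rw [List.nil_append, List.cons.injEq] at h
      rcases List.append_eq_append_iff.1 h.2 with ⟨s, hs, hg⟩ | ⟨s, hs, hg⟩
      · rcases s with _ | ⟨c, s⟩
        · simp [hs]
        · rcases staircase_eq_nil_or_cons a b (j + 1) k with h0 | ⟨t, h0⟩
          · simp [h0] at hg
          · rw [h0, List.cons_append, List.cons.injEq] at hg
            exact absurd (by rw [hs, ← hg.1]; simp) hy
      · rcases s with _ | ⟨c, s⟩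
        · have := congrArg List.length hs
          simpa using this.symm
        · rw [List.cons_append, List.cons.injEq] at hg
          rw [← hg.1] at hs
          exact absurd hs hrep
    · rw [List.cons_append, List.cons.injEq] at h
      obtain ⟨rfl, h⟩ := h
      rcases List.append_eq_append_iff.1 h with ⟨s, hs, hg⟩ | ⟨s, hs, hg⟩
      · have := ih (j + 1) s hg
        simp only [hs, this, List.count_cons_self, List.count_append, List.count_replicate]
        simp [hab]
        omega
      · rcases s with _ | ⟨c, s⟩
        · have := ih (j + 1) [] hg.symm
          rw [List.append_nil] at hs
          simp only [← hs, this, List.count_cons_self, List.count_replicate]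
          simp [hab]
        · rw [List.cons_append, List.cons.injEq] at hg
          rw [← hg.1] at hs
          exact absurd hs hrep

theorem count_le_two_of_palindrome {A : Type u} [DecidableEq A] {a b : A} (hab : a ≠ b) {j k : ℕ}
    {p : List A} (hp : p.Palindrome) (hpw : p <:+: staircase a b j k) : p.count b ≤ 2 := by
  by_contra! hcount
  obtain ⟨X, Y, hXY⟩ := hpw
  obtain ⟨x, t, rfl, hx⟩ := List.eq_append_cons_of_mem
    (List.count_pos_iff.1 (by omega : 0 < p.count b))
  have hx0 : x.count b = 0 := List.count_eq_zero.2 hx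
  have ht : 0 < t.count b := by
    simp [hx0] at hcount
    omega
  obtain ⟨y, z, rfl, hy⟩ := List.eq_append_cons_of_mem (List.count_pos_iff.1 ht)
  have hy0 : y.count b = 0 := List.count_eq_zero.2 hy
  have h1 := length_run_staircase hab (y := y) (Y := z ++ Y) hy k j (X ++ x) (by
    rw [← hXY]; simp)
  -- reading the palindrome backwards, the run `y` is also its last inner run
  have h2 := length_run_staircase hab (y := y.reverse) (Y := x.reverse ++ Y) (by simpa using hy)
    k j (X ++ z.reverse) (by rw [← hXY, ← hp.reverse_eq]; simp)
  simp only [List.length_reverse, List.count_append, List.count_reverse, hx0] at h1 h2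
  simp only [List.count_append, List.count_cons_self, hx0, hy0] at hcount
  omega

theorem staircase_le_two_mul_palLength {A : Type u} {a b : A} (hab : a ≠ b) (k : ℕ) :
    k ≤ 2 * palLength (staircase a b 1 k) := by
  classical
  obtain ⟨ps, hlen, hpal, hfl⟩ := palLength_spec (staircase a b 1 k)
  have h : ∀ qs : List (List A), (∀ p ∈ qs, p.count b ≤ 2) → qs.flatten.count b ≤ 2 * qs.length := by
    intro qs
    induction qs with
    | nil => simp
    | cons p qs ih =>
      intro hq
      have h1 := ih fun r hr => hq r (List.mem_cons_of_mem _ hr)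
      have h2 := hq p List.mem_cons_self
      simp only [List.flatten_cons, List.count_append, List.length_cons]
      omega
  have := h ps fun p hp =>
    count_le_two_of_palindrome hab (hpal p hp) (by
      rw [← hfl]
      exact List.infix_of_mem_flatten hp)
  rwa [hfl, count_staircase hab, hlen] at this

/-! ### Richness of the staircase words -/

theorem replicate_suffix_staircase {A : Type u} (a b : A) {i k : ℕ} (h : i ≤ k) :
    List.replicate i a <:+ staircase a b 1 k := by
  cases k with
  | zero => simp [Nat.le_zero.1 h]
  | succ k =>
    rw [staircase_succ]
    refine ⟨staircase a b 1 k ++ b :: List.replicate (1 + k - i) a, ?_⟩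
    rw [List.append_assoc, List.cons_append, ← List.replicate_add]
    congr 3
    omega

theorem staircase_prefix {A : Type u} (a b : A) (j : ℕ) {k l : ℕ} (h : k ≤ l) :
    staircase a b j k <+: staircase a b j l := by
  induction l, h using Nat.le_induction with
  | base => exact List.prefix_rfl
  | succ l _ ih => exact ih.trans (by rw [staircase_succ]; exact List.prefix_append _ _)

theorem replicate_append_cons_inj {A : Type u} {a b : A} (hab : a ≠ b) :
    ∀ {i j : ℕ} {s t : List A},
      List.replicate i a ++ b :: s = List.replicate j a ++ b :: t → i = j ∧ s = t
  | 0, 0, _, _, h => ⟨rfl, (List.cons.inj h).2⟩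
  | 0, j + 1, _, _, h => absurd (List.cons.inj h).1.symm hab
  | i + 1, 0, _, _, h => absurd (List.cons.inj h).1 hab
  | i + 1, j + 1, _, _, h => by
    obtain ⟨h1, h2⟩ := replicate_append_cons_inj hab (List.cons.inj h).2
    exact ⟨by rw [h1], h2⟩

/-- The staircase word attains the maximal number of palindromic factors: it contains `aⁱ` for
`i ≤ k`, `aⁱ b aⁱ` for `i < k`, and `aⁱ b aᵐ b aⁱ` for `i < m < k`. -/
theorem isRich_staircase {A : Type u} {a b : A} (hab : a ≠ b) (k : ℕ) :
    IsRich (staircase a b 1 k) := by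
  classical
  let S₀ : Finset (List A) := (Finset.range (k + 1)).image fun i => List.replicate i a
  let S₁ : Finset (List A) :=
    (Finset.range k).image fun i => List.replicate i a ++ b :: List.replicate i a
  let f : (Σ _ : ℕ, ℕ) → List A := fun x =>
    List.replicate x.2 a ++ b :: (List.replicate x.1 a ++ b :: List.replicate x.2 a)
  let S₂ : Finset (List A) := ((Finset.range k).sigma fun m => Finset.range m).image f
  have hS₀ : S₀.card = k + 1 := by
    rw [Finset.card_image_of_injective _ (List.replicate_left_injective a), Finset.card_range]
  have hS₁ : S₁.card = k := by
    rw [Finset.card_image_of_injective, Finset.card_range]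
    exact fun i j h => (replicate_append_cons_inj hab h).1
  have hS₂ : S₂.card = ∑ m ∈ Finset.range k, m := by
    rw [Finset.card_image_of_injective, Finset.card_sigma]
    · simp
    · rintro ⟨m, i⟩ ⟨m', i'⟩ h
      obtain ⟨h1, h2⟩ := replicate_append_cons_inj hab h
      obtain ⟨h3, -⟩ := replicate_append_cons_inj hab h2
      simp only at h1 h3
      rw [h1, h3]
  -- the number of letters `b` tells the three kinds apart
  have c₀ : ∀ p ∈ S₀, p.count b = 0 := by
    intro p hp
    obtain ⟨i, -, rfl⟩ := Finset.mem_image.1 hp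
    simp [List.count_replicate, hab]
  have c₁ : ∀ p ∈ S₁, p.count b = 1 := by
    intro p hp
    obtain ⟨i, -, rfl⟩ := Finset.mem_image.1 hp
    simp [List.count_replicate, hab]
  have c₂ : ∀ p ∈ S₂, p.count b = 2 := by
    intro p hp
    obtain ⟨i, -, rfl⟩ := Finset.mem_image.1 hp
    simp [f, List.count_replicate, hab]
  have d₁ : Disjoint S₀ S₁ := Finset.disjoint_left.2 fun p h0 h1 => by
    have := c₀ p h0
    have := c₁ p h1
    omega
  have d₂ : Disjoint (S₀ ∪ S₁) S₂ := Finset.disjoint_left.2 fun p h01 h2 => by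
    have := c₂ p h2
    rcases Finset.mem_union.1 h01 with h | h
    · have := c₀ p h
      omega
    · have := c₁ p h
      omega
  have hsub : ((S₀ ∪ S₁ ∪ S₂ : Finset (List A)) : Set (List A)) ⊆
      palindromicFactors (staircase a b 1 k) := by
    intro p hp
    rcases Finset.mem_union.1 (Finset.mem_coe.1 hp) with hp | hp
    · rcases Finset.mem_union.1 hp with hp | hp
      · obtain ⟨i, hi, rfl⟩ := Finset.mem_image.1 hp
        rw [Finset.mem_range] at hi
        exact ⟨(replicate_suffix_staircase a b (by omega)).isInfix,
          List.Palindrome.of_reverse_eq (by simp)⟩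
      · obtain ⟨i, hi, rfl⟩ := Finset.mem_image.1 hp
        rw [Finset.mem_range] at hi
        refine ⟨List.IsInfix.trans ?_ (staircase_prefix a b 1 (show i + 1 ≤ k from hi)).isInfix,
          List.Palindrome.of_reverse_eq (by simp)⟩
        obtain ⟨s, hs⟩ := replicate_suffix_staircase a b (le_refl i)
        refine ⟨s, List.replicate 1 a, ?_⟩
        rw [staircase_succ, ← hs, Nat.add_comm 1 i, List.replicate_add]
        simp
    · obtain ⟨⟨m, i⟩, hmi, rfl⟩ := Finset.mem_image.1 hp
      simp only [Finset.mem_sigma, Finset.mem_range] at hmi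
      obtain ⟨hm, hi⟩ := hmi
      refine ⟨List.IsInfix.trans ?_ (staircase_prefix a b 1 (show m + 1 ≤ k from hm)).isInfix,
        List.Palindrome.of_reverse_eq (by simp [f])⟩
      obtain ⟨m, rfl⟩ : ∃ l, m = l + 1 := ⟨m - 1, by omega⟩
      obtain ⟨s, hs⟩ := replicate_suffix_staircase a b (show i ≤ m by omega)
      refine ⟨s, List.replicate (1 + (m + 1) - i) a, ?_⟩
      have h1 : List.replicate (1 + (m + 1)) a =
          List.replicate i a ++ List.replicate (1 + (m + 1) - i) a := by
        rw [← List.replicate_add]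
        congr 1
        omega
      rw [staircase_succ, staircase_succ, h1, ← hs, Nat.add_comm 1 m]
      simp [f]
  have hcard := Set.ncard_le_ncard hsub (palindromicFactors_finite _)
  rw [Set.ncard_coe_finset, Finset.card_union_of_disjoint d₂, Finset.card_union_of_disjoint d₁,
    hS₀, hS₁, hS₂] at hcard
  refine le_antisymm (ncard_palindromicFactors_le _) ?_
  rw [length_staircase]
  omega

theorem sqrt_length_staircase_le {A : Type u} (a b : A) (k : ℕ) :
    Real.sqrt ((staircase a b 1 k).length : ℝ) ≤ 2 * k := by
  have h : (staircase a b 1 k).length ≤ (2 * k) ^ 2 := by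
    have h2 := Finset.sum_range_id_mul_two k
    rw [length_staircase]
    have h3 : k * (k - 1) ≤ k * k := Nat.mul_le_mul_left k (Nat.sub_le k 1)
    have h4 : k ≤ k * k := Nat.le_mul_self k
    nlinarith
  refine Real.sqrt_le_iff.2 ⟨by positivity, ?_⟩
  exact_mod_cast h

theorem corollaryc :
    ∃ c : ℝ, 0 < c ∧ ∀ q : ℕ, ∃ d : ℝ, 1 < d ∧
      ∀ (A : Type u) [Fintype A], Fintype.card A = q →
        (2 ≤ q →
          {w : List A | IsRich w ∧ c * Real.sqrt (w.length : ℝ) ≤ (palLength w : ℝ)}.Infinite) ∧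
        (∀ w : List A, IsRich w → 2 ≤ w.length →
          (palLength w : ℝ) ≤ d * ((w.length : ℝ) / Real.log (w.length : ℝ))) := by
  refine ⟨1 / 4, by norm_num, fun q =>
    ⟨2 * Real.log ((q + 2 : ℕ) : ℝ) + 2 * ((q + 2 : ℕ) : ℝ), ?_, ?_⟩⟩
  · have h1 : 0 ≤ Real.log ((q + 2 : ℕ) : ℝ) := Real.log_natCast_nonneg _
    have h2 : (2 : ℝ) ≤ ((q + 2 : ℕ) : ℝ) := by exact_mod_cast Nat.le_add_left 2 q
    linarith
  · rintro A _ rfl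
    refine ⟨fun hq => ?_, fun w hw hlen => hw.palLength_le hlen⟩
    classical
    obtain ⟨a, b, hab⟩ := Fintype.exists_pair_of_one_lt_card (show 1 < Fintype.card A from hq)
    refine Set.infinite_of_injective_forall_mem (f := fun k => staircase a b 1 k) ?_ ?_
    · intro k l h
      have := congrArg (List.count b) h
      simpa only [count_staircase hab] using this
    · intro k
      refine ⟨isRich_staircase hab k, ?_⟩
      have h1 := sqrt_length_staircase_le a b k
      have h2 : (k : ℝ) ≤ 2 * palLength (staircase a b 1 k) := by
        exact_mod_cast staircase_le_two_mul_palLength hab k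
      linarith
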